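/- Definitions. Let $\mu,\nu$ be probability measures on a measurable space $\Omega$ (a metric space $\Omega$ carries its Borel $\sigma$-algebra); let $f,g$ be their densities with respect to a dominating measure $\lambda$ (for instance $\lambda=\mu+\nu$), and on $\mathbb R$ let $F,G$ be their distribution functions. Put - Lévy (on $\mathbb R$): $d_L(\mu,\nu)=\inf\{\epsilon>0: G(x-\epsilon)-\epsilon\le F(x)\le G(x+\epsilon)+\epsilon\ \ \forall x\in\mathbb R\}$; - Kolmogorov (on $\mathbb R$): $d_K(\mu,\nu)=\sup_{x\in\mathbb R}|F(x)-G(x)|$; - discrepancy (metric spaces): $d_D(\mu,\nu)=\sup_B|\mu(B)-\nu(B)|$ over all closed balls $B$; - Prokhorov (metric spaces): $d_P(\mu,\nu)=\inf\{\epsilon>0:\mu(B)\le\nu(B^\epsilon)+\epsilon \text{ for all Borel } B\}$, where $B^\epsilon=\{x:\inf_{y\in B}d(x,y)\le\epsilon\}$; - Wasserstein/Kantorovich (metric spaces): $d_W(\mu,\nu)=\sup\left|\int h\,d\mu-\int h\,d\nu\right|\in[0,\infty]$ over all $h:\Omega\to\mathbb R$ with $|h(x)-h(y)|\le d(x,y)$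 that are integrable for $\mu$ and $\nu$; - total variation: $d_{TV}(\mu,\nu)=\sup_A|\mu(A)-\nu(A)|$ over all measurable $A$; - Hellinger: $d_H(\mu,\nu)=\left(\int(\sqrt f-\sqrt g)^2\,d\lambda\right)^{1/2}$; - relative entropy: $d_I(\mu,\nu)=\int_{\{f>0\}} f\log(f/g)\,d\lambda\in[0,\infty]$; - $\chi^2$-distance: $d_{\chi^2}(\mu,\nu)=\int_{\{f>0\}\cup\{g>0\}}(f-g)^2/g\,d\lambda\in[0,\infty]$ (with $c/0=\infty$ for $c>0$); - separation (countable $\Omega$): $d_S(\mu,\nu)=\sup_{i:\,\nu(i)>0}\left(1-\mu(i)/\nu(i)\right)$. Say that $d$ *metrizes weak convergence* on $\Omega$ if $d$ is a metric on the set of probability measures on $\Omega$ whose topology is the topology of weak convergence, and that $d$-convergence *implies weak convergence* if, for all probability measures $\mu_n,\nu$ on $\Omega$, $d(\mu_n,\nu)\to0$ implies $\mu_n\to\nu$ weakly. **Theorem.** 1. On $\mathbb R$, the Lévy metric metrizes weak convergence. Convergence under the discrepancy metric and convergence under the Kolmogorov metric each imply weak convergence. If $\nu$ is absolutely continuous with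 respect to Lebesgue measure, then for every sequence $(\mu_n)$ of probability measures on $\mathbb R$: $\mu_n\to\nu$ weakly $\iff d_D(\mu_n,\nu)\to0 \iff d_K(\mu_n,\nu)\to 0$. 2. On every separable metric space the Prokhorov metric metrizes weak convergence. On every metric space convergence under the Wasserstein metric implies weak convergence. 3. Let $\Omega$ be a bounded metric space. If $\Omega$ is separable, the Wasserstein metric metrizes weak convergence. Convergence under any of the following implies weak convergence: total variation, Hellinger, separation (for countable $\Omega$), relative entropy, and the $\chi^2$-distance. For the last three, which are not symmetric, this holds for both orders of the arguments: $d(\mu_n,\nu)\to0$ implies $\mu_n\to\nu$ weakly, and so does $d(\nu,\mu_n)\to0$. 4. If $\Omega$ is a bounded and finite metric space, then the total variation metric and the Hellinger metric both metrize weak convergence. -/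

import Mathlib

open MeasureTheory ProbabilityTheory Filter Topology
open scoped ENNReal

/-! Distances between probability measures.  All of them take values in `[0, ∞]`; the suprema and
infima below are therefore never junk values. -/

namespace ProbMetric

noncomputable section

/-- Lévy distance on `ℝ`:
`inf {ε > 0 : G (x - ε) - ε ≤ F x ≤ G (x + ε) + ε for all x}`, with `F`, `G` the distribution
functions of `μ`, `ν`.  The set contains `1`. -/
def levy (μ ν : ProbabilityMeasure ℝ) : ℝ≥0∞ :=
  ENNReal.ofReal (sInf {ε : ℝ | 0 < ε ∧ ∀ x : ℝ,
    cdf (ν : Measure ℝ) (x - ε) - ε ≤ cdf (μ : Measure ℝ) x ∧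
    cdf (μ : Measure ℝ) x ≤ cdf (ν : Measure ℝ) (x + ε) + ε})

/-- Kolmogorov (uniform) distance on `ℝ`: `sup_x |F x - G x|`. -/
def kolmogorov (μ ν : ProbabilityMeasure ℝ) : ℝ≥0∞ :=
  ⨆ x : ℝ, ENNReal.ofReal |cdf (μ : Measure ℝ) x - cdf (ν : Measure ℝ) x|

section MetricSpaces

variable {Ω : Type*} [MetricSpace Ω] [MeasurableSpace Ω]

/-- Discrepancy: supremum of `|μ B - ν B|` over all closed balls `B`. -/
def discrepancy (μ ν : ProbabilityMeasure Ω) : ℝ≥0∞ :=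
  ⨆ (x : Ω) (r : ℝ) (_ : 0 ≤ r), ENNReal.ofReal
    |(μ : Measure Ω).real (Metric.closedBall x r) - (ν : Measure Ω).real (Metric.closedBall x r)|

/-- Prokhorov distance: `inf {ε > 0 : μ B ≤ ν (B^ε) + ε for all Borel sets B}`, where
`B^ε = {x : inf_{y ∈ B} d(x, y) ≤ ε}`.  The set contains `1`. -/
def prokhorov (μ ν : ProbabilityMeasure Ω) : ℝ≥0∞ :=
  ENNReal.ofReal (sInf {ε : ℝ | 0 < ε ∧ ∀ B : Set Ω, MeasurableSet B →
    (μ : Measure Ω) B ≤ (ν : Measure Ω) (Metric.cthickening ε B) + ENNReal.ofReal ε})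

/-- Wasserstein (Kantorovich) distance: supremum of `|∫ h dμ - ∫ h dν|` over all functions `h`
with `|h x - h y| ≤ d(x, y)` for which both integrals exist. -/
def wasserstein (μ ν : ProbabilityMeasure Ω) : ℝ≥0∞ :=
  ⨆ (h : Ω → ℝ) (_ : ∀ x y, |h x - h y| ≤ dist x y)
    (_ : Integrable h (μ : Measure Ω)) (_ : Integrable h (ν : Measure Ω)),
    ENNReal.ofReal |∫ x, h x ∂(μ : Measure Ω) - ∫ x, h x ∂(ν : Measure Ω)|

end MetricSpaces

section MeasurableSpaces

variable {Ω : Type*} [MeasurableSpace Ω]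

/-- Total variation distance: supremum of `|μ A - ν A|` over all measurable sets `A`. -/
def totalVariation (μ ν : ProbabilityMeasure Ω) : ℝ≥0∞ :=
  ⨆ (A : Set Ω) (_ : MeasurableSet A),
    ENNReal.ofReal |(μ : Measure Ω).real A - (ν : Measure Ω).real A|

/-- A measure dominating both `μ` and `ν`, with respect to which densities are taken. -/
def dominating (μ ν : ProbabilityMeasure Ω) : Measure Ω := (μ : Measure Ω) + (ν : Measure Ω)

/-- Hellinger distance: `(∫ (√f - √g)² dλ)^(1/2)`, with `f`, `g` the densities of `μ`, `ν` with
respect to the dominating measure `λ`. -/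
def hellinger (μ ν : ProbabilityMeasure Ω) : ℝ≥0∞ :=
  (∫⁻ x, ENNReal.ofReal
    ((√((μ : Measure Ω).rnDeriv (dominating μ ν) x).toReal -
      √((ν : Measure Ω).rnDeriv (dominating μ ν) x).toReal) ^ 2) ∂(dominating μ ν)) ^ (1 / 2 : ℝ)

/-- Chi-square distance: `∫ (f - g)² / g dλ`, with `f`, `g` the densities of `μ`, `ν` with respect
to the dominating measure `λ`.  The quotient is taken in `[0, ∞]`: it is `∞` where `g = 0 < f`,
and it is `0` where `f = g = 0`, that is, outside the union of the supports. -/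
def chiSquare (μ ν : ProbabilityMeasure Ω) : ℝ≥0∞ :=
  ∫⁻ x, ENNReal.ofReal
    ((((μ : Measure Ω).rnDeriv (dominating μ ν) x).toReal -
      ((ν : Measure Ω).rnDeriv (dominating μ ν) x).toReal) ^ 2) /
      (ν : Measure Ω).rnDeriv (dominating μ ν) x ∂(dominating μ ν)

/-- Relative entropy `∫ f log (f / g) dλ`; it is `∞` if `μ` is not dominated by `ν`. -/
def relativeEntropy (μ ν : ProbabilityMeasure Ω) : ℝ≥0∞ :=
  InformationTheory.klDiv (μ : Measure Ω) (ν : Measure Ω)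

/-- Separation distance, used on countable spaces: supremum of `1 - μ i / ν i` over the points `i`
with `ν i > 0`.  The subtraction in `[0, ∞]` truncates negative values to `0`, which does not change
the supremum because `μ i ≤ ν i` for some `i` with `ν i > 0`. -/
def separation (μ ν : ProbabilityMeasure Ω) : ℝ≥0∞ :=
  ⨆ (i : Ω) (_ : (ν : Measure Ω) {i} ≠ 0), (1 - (μ : Measure Ω) {i} / (ν : Measure Ω) {i})

end MeasurableSpaces

section WeakConvergence

variable {Ω : Type*} [MetricSpace Ω] [MeasurableSpace Ω] [BorelSpace Ω]

/-- `d` metrizes weak convergence: `d` is a (finite) metric on the probability measures on `Ω`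
and the topology of this metric is the topology of weak convergence. -/
def MetrizesWeak (d : ProbabilityMeasure Ω → ProbabilityMeasure Ω → ℝ≥0∞) : Prop :=
  ∃ m : MetricSpace (ProbabilityMeasure Ω),
    (∀ μ ν, d μ ν = ENNReal.ofReal (m.dist μ ν)) ∧
    m.toUniformSpace.toTopologicalSpace =
      ProbabilityMeasure.instTopologicalSpace (Ω := Ω)

/-- `d (μ n) ν → 0` implies that `μ n` converges weakly to `ν`. -/
def ImpliesWeak (d : ProbabilityMeasure Ω → ProbabilityMeasure Ω → ℝ≥0∞) : Prop :=
  ∀ (μ : ℕ → ProbabilityMeasure Ω) (ν : ProbabilityMeasure Ω),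
    Tendsto (fun n => d (μ n) ν) atTop (𝓝 0) → Tendsto μ atTop (𝓝 ν)

/-- For sequences with limit `ν`, weak convergence and `d`-convergence are the same. -/
def MetrizesWeakAt (d : ProbabilityMeasure Ω → ProbabilityMeasure Ω → ℝ≥0∞)
    (ν : ProbabilityMeasure Ω) : Prop :=
  ∀ μ : ℕ → ProbabilityMeasure Ω,
    Tendsto μ atTop (𝓝 ν) ↔ Tendsto (fun n => d (μ n) ν) atTop (𝓝 0)

end WeakConvergence

end

end ProbMetric

/-! Each distance is compared with one whose link to weak convergence is direct. On a general space
the anchor is total variation: if it tends to zero, `ν G ≤ liminf μ_n G` for open `G`, which is the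
portmanteau criterion. Hellinger, relative entropy and chi-square control it through weighted AM-GM
inequalities between densities, `TV ≤ c⁻¹ * d + c` for every `c > 0` (with `d` the squared Hellinger
distance in that case); separation bounds it directly. As total variation is symmetric, both
argument orders follow. Prokhorov's metric equals `levyProkhorovDist`, which metrizes weak
convergence on separable spaces. Wasserstein convergence tests all bounded Lipschitz functions; on a
bounded space a layer-cake estimate conversely bounds it by a multiple of Prokhorov. On `ℝ`, Lévy
convergence gives convergence of distribution functions at continuity points of the limit, hence
weak convergence, and `levy ≤ prokhorov` gives the converse. The chain `levy ≤ kolmogorov ≤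
discrepancy ≤ 2 * kolmogorov` settles the other two. For absolutely continuous `ν` the distribution
function is uniformly continuous, so Lévy closeness becomes uniform closeness. On finite spaces
every set is clopen, so weak convergence is convergence of all masses. -/

namespace ProbMetric

/-! ### From convergence of sequences to metrization; transfer between distances -/

section General

variable {Ω : Type*} [MetricSpace Ω] [MeasurableSpace Ω] [BorelSpace Ω]
  {d d' : ProbabilityMeasure Ω → ProbabilityMeasure Ω → ℝ≥0∞}

theorem MetrizesWeakAt.self_eq_zero {ν : ProbabilityMeasure Ω} (h : MetrizesWeakAt d ν) :
    d ν ν = 0 :=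
  tendsto_nhds_unique tendsto_const_nhds ((h fun _ => ν).1 tendsto_const_nhds)

/-- A finite, symmetric function with the triangle inequality that detects the weak convergence of
sequences metrizes weak convergence on a separable space. -/
theorem MetrizesWeak.of_metrizesWeakAt [TopologicalSpace.SeparableSpace Ω]
    (hfin : ∀ μ ν, d μ ν ≠ ∞) (hsymm : ∀ μ ν, d μ ν = d ν μ)
    (htri : ∀ μ ν κ, d μ κ ≤ d μ ν + d ν κ) (h : ∀ ν, MetrizesWeakAt d ν) :
    MetrizesWeak d := by
  let m : MetricSpace (ProbabilityMeasure Ω) :=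
    { dist := fun μ ν => (d μ ν).toReal
      dist_self := fun μ => by simp [(h μ).self_eq_zero]
      dist_comm := fun μ ν => by rw [hsymm]
      dist_triangle := fun μ ν κ => by
        rw [← ENNReal.toReal_add (hfin _ _) (hfin _ _)]
        exact ENNReal.toReal_mono (ENNReal.add_ne_top.2 ⟨hfin _ _, hfin _ _⟩) (htri μ ν κ)
      -- The constant sequence `μ` then converges weakly to `ν`, and the weak topology is Hausdorff.
      eq_of_dist_eq_zero := fun {μ ν} h0 => by
        have h1 : d μ ν = 0 := ((ENNReal.toReal_eq_zero_iff _).1 h0).resolve_right (hfin _ _)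
        exact tendsto_nhds_unique tendsto_const_nhds
          ((h ν fun _ => μ).2 (by simp [h1])) }
  have key : ∀ (u : ℕ → ProbabilityMeasure Ω) (ν : ProbabilityMeasure Ω),
      Tendsto u atTop (@nhds _ m.toUniformSpace.toTopologicalSpace ν) ↔
        Tendsto u atTop (𝓝 ν) := fun u ν => by
    rw [h ν u, @tendsto_iff_dist_tendsto_zero _ _ m.toPseudoMetricSpace]
    exact ENNReal.tendsto_toReal_zero_iff (fun n => hfin _ _)
  -- Both topologies are sequential, the weak one because `Ω` is separable, so agreement on
  -- convergent sequences suffices.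
  refine ⟨m, fun μ ν => (ENNReal.ofReal_toReal (hfin _ _)).symm, le_antisymm ?_ ?_⟩
  · refine continuous_id_iff_le.1 ?_
    refine @SeqContinuous.continuous _ _ m.toUniformSpace.toTopologicalSpace _
      inferInstance _ fun u ν hu => ?_
    exact (key u ν).1 hu
  · refine continuous_id_iff_le.1 ?_
    refine @SeqContinuous.continuous _ _ _ m.toUniformSpace.toTopologicalSpace _ _ fun u ν hu => ?_
    exact (key u ν).2 hu

theorem ImpliesWeak.metrizesWeakAt (h : ImpliesWeak d)
    (h' : ∀ (μ : ℕ → ProbabilityMeasure Ω) (ν : ProbabilityMeasure Ω), Tendsto μ atTop (𝓝 ν) →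
      Tendsto (fun n => d (μ n) ν) atTop (𝓝 0)) (ν : ProbabilityMeasure Ω) :
    MetrizesWeakAt d ν :=
  fun μ => ⟨h' μ ν, h μ ν⟩

/-- For fixed `c` the right side tends to `c`, and `c` is arbitrary. This linear family replaces a
bound of the form `u ≤ 2 * √v`, which is its optimum over `c`. -/
theorem tendsto_zero_of_forall_le {u v : ℕ → ℝ≥0∞}
    (h : ∀ c : ℝ, 0 < c → ∀ᶠ n in atTop, u n ≤ ENNReal.ofReal c⁻¹ * v n + ENNReal.ofReal c)
    (hv : Tendsto v atTop (𝓝 0)) : Tendsto u atTop (𝓝 0) := by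
  rw [ENNReal.tendsto_nhds_zero]
  intro ε hε
  obtain ⟨c, hc, hcε⟩ : ∃ c : ℝ, 0 < c ∧ ENNReal.ofReal c < ε := by
    obtain ⟨δ, hδ, hδε⟩ := exists_between hε
    have hδ' : δ ≠ ∞ := (hδε.trans_le le_top).ne
    exact ⟨δ.toReal, ENNReal.toReal_pos hδ.ne' hδ', by rwa [ENNReal.ofReal_toReal hδ']⟩
  have h1 : Tendsto (fun n => ENNReal.ofReal c⁻¹ * v n + ENNReal.ofReal c) atTop
      (𝓝 (ENNReal.ofReal c⁻¹ * 0 + ENNReal.ofReal c)) :=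
    (ENNReal.Tendsto.const_mul hv (Or.inr ENNReal.ofReal_ne_top)).add tendsto_const_nhds
  rw [mul_zero, zero_add] at h1
  filter_upwards [h c hc, h1.eventually_lt_const hcε] with n h2 h3
  exact h2.trans h3.le

theorem ImpliesWeak.of_forall_le (hd : ImpliesWeak d)
    (h : ∀ c : ℝ, 0 < c → ∀ μ ν, d μ ν ≤ ENNReal.ofReal c⁻¹ * d' μ ν + ENNReal.ofReal c) :
    ImpliesWeak d' :=
  fun μ ν hμ => hd μ ν <|
    tendsto_zero_of_forall_le (fun c hc => Eventually.of_forall fun n => h c hc (μ n) ν) hμ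

theorem ImpliesWeak.mono (hd : ImpliesWeak d) (h : ∀ μ ν, d μ ν ≤ d' μ ν) : ImpliesWeak d' :=
  fun μ ν hμ => hd μ ν <|
    tendsto_of_tendsto_of_tendsto_of_le_of_le tendsto_const_nhds hμ (fun _ => zero_le)
      fun n => h (μ n) ν

end General

/-! ### Upper bounds for total variation -/

section TotalVariation

variable {Ω : Type*} [MeasurableSpace Ω]

theorem totalVariation_comm (μ ν : ProbabilityMeasure Ω) :
    totalVariation μ ν = totalVariation ν μ := by
  simp only [totalVariation, abs_sub_comm]

theorem totalVariation_triangle (μ ν κ : ProbabilityMeasure Ω) :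
    totalVariation μ κ ≤ totalVariation μ ν + totalVariation ν κ := by
  refine iSup₂_le fun A hA => ?_
  calc _ ≤ ENNReal.ofReal |(μ : Measure Ω).real A - (ν : Measure Ω).real A| +
        ENNReal.ofReal |(ν : Measure Ω).real A - (κ : Measure Ω).real A| := by
        rw [← ENNReal.ofReal_add (abs_nonneg _) (abs_nonneg _)]
        exact ENNReal.ofReal_le_ofReal (abs_sub_le _ _ _)
    _ ≤ _ := add_le_add
        (le_iSup₂ (f := fun (A : Set Ω) (_ : MeasurableSet A) =>
          ENNReal.ofReal |(μ : Measure Ω).real A - (ν : Measure Ω).real A|) A hA)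
        (le_iSup₂ (f := fun (A : Set Ω) (_ : MeasurableSet A) =>
          ENNReal.ofReal |(ν : Measure Ω).real A - (κ : Measure Ω).real A|) A hA)

/-- The one-sided bound applied to `Aᶜ` gives the opposite inequality for `A`, since both total
masses are one. -/
theorem totalVariation_le_of_forall_le_add {μ ν : ProbabilityMeasure Ω} {s : ℝ≥0∞}
    (h : ∀ A, MeasurableSet A → (μ : Measure Ω) A ≤ (ν : Measure Ω) A + s) :
    totalVariation μ ν ≤ s := by
  rcases eq_or_ne s ∞ with rfl | hs
  · exact le_top
  have key : ∀ A, MeasurableSet A →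
      (μ : Measure Ω).real A ≤ (ν : Measure Ω).real A + s.toReal := fun A hA => by
    rw [Measure.real, Measure.real, ← ENNReal.toReal_add (measure_ne_top _ _) hs]
    exact ENNReal.toReal_mono (ENNReal.add_ne_top.2 ⟨measure_ne_top _ _, hs⟩) (h A hA)
  refine iSup₂_le fun A hA => ?_
  rw [ENNReal.ofReal_le_iff_le_toReal hs, abs_le]
  have h1 := key A hA
  have h2 := key Aᶜ hA.compl
  rw [probReal_compl_eq_one_sub hA, probReal_compl_eq_one_sub hA] at h2
  constructor <;> linarith

theorem totalVariation_ne_top (μ ν : ProbabilityMeasure Ω) : totalVariation μ ν ≠ ∞ := by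
  refine ((totalVariation_le_of_forall_le_add (s := 1) fun A _ => ?_).trans_lt
    ENNReal.one_lt_top).ne
  exact prob_le_one.trans le_add_self

theorem le_add_totalVariation (μ ν : ProbabilityMeasure Ω) {A : Set Ω} (hA : MeasurableSet A) :
    (μ : Measure Ω) A ≤ (ν : Measure Ω) A + totalVariation μ ν := by
  have h : ENNReal.ofReal |(μ : Measure Ω).real A - (ν : Measure Ω).real A| ≤
      totalVariation μ ν :=
    le_iSup₂ (f := fun (A : Set Ω) (_ : MeasurableSet A) =>
      ENNReal.ofReal |(μ : Measure Ω).real A - (ν : Measure Ω).real A|) A hA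
  refine le_trans ?_ (add_le_add le_rfl h)
  rw [← ofReal_measureReal (μ := (μ : Measure Ω)), ← ofReal_measureReal (μ := (ν : Measure Ω)),
    ← ENNReal.ofReal_add measureReal_nonneg (abs_nonneg _)]
  exact ENNReal.ofReal_le_ofReal (by linarith [le_abs_self ((μ : Measure Ω).real A -
    (ν : Measure Ω).real A)])

theorem totalVariation_le_lintegral {μ ν : ProbabilityMeasure Ω} {ρ : Measure Ω} [SigmaFinite ρ]
    (hμ : (μ : Measure Ω) ≪ ρ) (hν : (ν : Measure Ω) ≪ ρ) :
    totalVariation μ ν ≤ ∫⁻ x, ENNReal.ofReal |((μ : Measure Ω).rnDeriv ρ x).toReal -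
      ((ν : Measure Ω).rnDeriv ρ x).toReal| ∂ρ := by
  refine iSup₂_le fun A hA => ?_
  rw [← Measure.setIntegral_toReal_rnDeriv hμ, ← Measure.setIntegral_toReal_rnDeriv hν,
    ← integral_sub Measure.integrable_toReal_rnDeriv.integrableOn
      Measure.integrable_toReal_rnDeriv.integrableOn, ← Real.norm_eq_abs, ofReal_norm]
  refine (enorm_integral_le_lintegral_enorm _).trans ?_
  refine (setLIntegral_le_lintegral _ _).trans (lintegral_mono fun x => ?_)
  rw [← Real.norm_eq_abs, ofReal_norm]

/-- The pointwise estimate is integrated; the two densities together have integral `2`, which turns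
`c / 2` into `c`. -/
theorem totalVariation_le_of_density {μ ν : ProbabilityMeasure Ω} {ρ : Measure Ω} [SigmaFinite ρ]
    (hμ : (μ : Measure Ω) ≪ ρ) (hν : (ν : Measure Ω) ≪ ρ) {φ : Ω → ℝ≥0∞} {c : ℝ}
    (h : ∀ᵐ x ∂ρ, ENNReal.ofReal |((μ : Measure Ω).rnDeriv ρ x).toReal -
        ((ν : Measure Ω).rnDeriv ρ x).toReal| ≤ ENNReal.ofReal c⁻¹ * φ x +
      ENNReal.ofReal (c / 2) * ((μ : Measure Ω).rnDeriv ρ x + (ν : Measure Ω).rnDeriv ρ x)) :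
    totalVariation μ ν ≤ ENNReal.ofReal c⁻¹ * ∫⁻ x, φ x ∂ρ + ENNReal.ofReal c := by
  refine (totalVariation_le_lintegral hμ hν).trans ((lintegral_mono_ae h).trans ?_)
  rw [lintegral_add_right _ (by fun_prop), lintegral_const_mul' _ _ ENNReal.ofReal_ne_top,
    lintegral_const_mul' _ _ ENNReal.ofReal_ne_top, lintegral_add_right _ (by fun_prop),
    Measure.lintegral_rnDeriv hμ, Measure.lintegral_rnDeriv hν, measure_univ, measure_univ,
    one_add_one_eq_two]
  have : ENNReal.ofReal (c / 2) * 2 = ENNReal.ofReal c := by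
    rw [show (2 : ℝ≥0∞) = ENNReal.ofReal 2 by simp, ← ENNReal.ofReal_mul' zero_le_two]
    congr 1; ring
  rw [this]

theorem absolutelyContinuous_dominating_left (μ ν : ProbabilityMeasure Ω) :
    (μ : Measure Ω) ≪ dominating μ ν :=
  (Measure.le_add_right le_rfl).absolutelyContinuous

theorem absolutelyContinuous_dominating_right (μ ν : ProbabilityMeasure Ω) :
    (ν : Measure Ω) ≪ dominating μ ν :=
  (Measure.le_add_left le_rfl).absolutelyContinuous

instance (μ ν : ProbabilityMeasure Ω) : IsFiniteMeasure (dominating μ ν) := by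
  unfold dominating; infer_instance

/-- With `s = √a` and `t = √b`, `|a - b| = |s - t| * (s + t)`; then weighted AM-GM and `(s + t) ^ 2
≤ 2 * (s ^ 2 + t ^ 2)`. -/
theorem abs_sub_le_sqrt_sub_sqrt_sq {a b c : ℝ} (ha : 0 ≤ a) (hb : 0 ≤ b) (hc : 0 < c) :
    |a - b| ≤ c⁻¹ * (√a - √b) ^ 2 + c / 2 * (a + b) := by
  obtain ⟨s, hs, rfl⟩ : ∃ s, 0 ≤ s ∧ s ^ 2 = a := ⟨√a, Real.sqrt_nonneg _, Real.sq_sqrt ha⟩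
  obtain ⟨t, ht, rfl⟩ : ∃ t, 0 ≤ t ∧ t ^ 2 = b := ⟨√b, Real.sqrt_nonneg _, Real.sq_sqrt hb⟩
  rw [Real.sqrt_sq hs, Real.sqrt_sq ht, show s ^ 2 - t ^ 2 = (s - t) * (s + t) by ring, abs_mul,
    abs_of_nonneg (add_nonneg hs ht)]
  have h1 : |s - t| * (s + t) ≤ c⁻¹ * |s - t| ^ 2 + c / 4 * (s + t) ^ 2 := by
    have h2 : c⁻¹ * |s - t| ^ 2 + c / 4 * (s + t) ^ 2 - |s - t| * (s + t) =
      c⁻¹ * (|s - t| - c / 2 * (s + t)) ^ 2 := by field_simp; ring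
    have h3 : 0 ≤ c⁻¹ * (|s - t| - c / 2 * (s + t)) ^ 2 := by positivity
    linarith
  rw [sq_abs] at h1
  have h4 : c / 4 * (s + t) ^ 2 ≤ c / 2 * (s ^ 2 + t ^ 2) := by
    nlinarith [mul_nonneg hc.le (sq_nonneg (s - t))]
  linarith

theorem totalVariation_le_hellinger_sq (μ ν : ProbabilityMeasure Ω) {c : ℝ} (hc : 0 < c) :
    totalVariation μ ν ≤ ENNReal.ofReal c⁻¹ * hellinger μ ν ^ 2 + ENNReal.ofReal c := by
  have h2 : hellinger μ ν ^ 2 = ∫⁻ x, ENNReal.ofReal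
    ((√((μ : Measure Ω).rnDeriv (dominating μ ν) x).toReal -
      √((ν : Measure Ω).rnDeriv (dominating μ ν) x).toReal) ^ 2) ∂(dominating μ ν) := by
    rw [hellinger, ← ENNReal.rpow_natCast, ← ENNReal.rpow_mul]; norm_num
  rw [h2]
  refine totalVariation_le_of_density (absolutelyContinuous_dominating_left μ ν)
    (absolutelyContinuous_dominating_right μ ν) ?_
  filter_upwards [(μ : Measure Ω).rnDeriv_ne_top (dominating μ ν),
    (ν : Measure Ω).rnDeriv_ne_top (dominating μ ν)] with x h3 h4
  have h5 := abs_sub_le_sqrt_sub_sqrt_sq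
    (ENNReal.toReal_nonneg (a := (μ : Measure Ω).rnDeriv (dominating μ ν) x))
    (ENNReal.toReal_nonneg (a := (ν : Measure Ω).rnDeriv (dominating μ ν) x)) hc
  refine (ENNReal.ofReal_le_ofReal h5).trans (le_of_eq ?_)
  rw [ENNReal.ofReal_add (by positivity) (by positivity), ENNReal.ofReal_mul (by positivity),
    ENNReal.ofReal_mul (by positivity), ENNReal.ofReal_add (by positivity) (by positivity),
    ENNReal.ofReal_toReal h3, ENNReal.ofReal_toReal h4]

/-- With `t = √x`, the bound `log t ≥ 1 - t⁻¹` gives `x * log x ≥ 2 * t ^ 2 - 2 * t`. This reduces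
entropy to the Hellinger integrand, with `√1` as the root of the density of `ν` relative to itself.
-/
theorem sqrt_sub_one_sq_le_klFun {x : ℝ} (hx : 0 ≤ x) :
    (√x - √1) ^ 2 ≤ InformationTheory.klFun x := by
  rcases hx.eq_or_lt with rfl | hx
  · simp [InformationTheory.klFun]
  obtain ⟨t, ht, rfl⟩ : ∃ t, 0 < t ∧ t ^ 2 = x := ⟨√x, Real.sqrt_pos.2 hx, Real.sq_sqrt hx.le⟩
  rw [Real.sqrt_sq ht.le, InformationTheory.klFun, Real.log_pow, Real.sqrt_one]
  have h1 := Real.one_sub_inv_le_log_of_pos ht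
  have h2 : t ^ 2 * (1 - t⁻¹) ≤ t ^ 2 * Real.log t := mul_le_mul_of_nonneg_left h1 (sq_nonneg t)
  have h3 : t ^ 2 * (1 - t⁻¹) = t ^ 2 - t := by field_simp
  push_cast
  nlinarith

theorem totalVariation_le_relativeEntropy (μ ν : ProbabilityMeasure Ω) {c : ℝ} (hc : 0 < c) :
    totalVariation μ ν ≤ ENNReal.ofReal c⁻¹ * relativeEntropy μ ν + ENNReal.ofReal c := by
  by_cases hμν : (μ : Measure Ω) ≪ ν
  swap
  -- Without absolute continuity the entropy is `∞`; otherwise `ν` itself serves as the dominating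
  -- measure.
  · rw [relativeEntropy, InformationTheory.klDiv_of_not_ac hμν, ENNReal.mul_top (by simpa)]
    simp
  rw [relativeEntropy, InformationTheory.klDiv_eq_lintegral_klFun_of_ac hμν]
  refine totalVariation_le_of_density hμν Measure.AbsolutelyContinuous.rfl ?_
  filter_upwards [(μ : Measure Ω).rnDeriv_ne_top ν, Measure.rnDeriv_self (ν : Measure Ω)]
    with x h3 h4
  rw [h4]
  have h5 := abs_sub_le_sqrt_sub_sqrt_sq
    (ENNReal.toReal_nonneg (a := (μ : Measure Ω).rnDeriv ν x)) zero_le_one hc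
  have h6 := sqrt_sub_one_sq_le_klFun (ENNReal.toReal_nonneg (a := (μ : Measure Ω).rnDeriv ν x))
  have h7 : |((μ : Measure Ω).rnDeriv ν x).toReal - 1| ≤
      c⁻¹ * InformationTheory.klFun ((μ : Measure Ω).rnDeriv ν x).toReal +
        c / 2 * (((μ : Measure Ω).rnDeriv ν x).toReal + 1) :=
    h5.trans (add_le_add (mul_le_mul_of_nonneg_left h6 (by positivity)) le_rfl)
  refine (ENNReal.ofReal_le_ofReal h7).trans (le_of_eq ?_)
  rw [ENNReal.ofReal_add (mul_nonneg (by positivity) ((sq_nonneg _).trans h6)) (by positivity),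
    ENNReal.ofReal_mul (by positivity),
    ENNReal.ofReal_mul (by positivity), ENNReal.ofReal_add (by positivity) (by positivity),
    ENNReal.ofReal_toReal h3, ENNReal.ofReal_one]

theorem totalVariation_le_chiSquare (μ ν : ProbabilityMeasure Ω) {c : ℝ} (hc : 0 < c) :
    totalVariation μ ν ≤ ENNReal.ofReal c⁻¹ * chiSquare μ ν + ENNReal.ofReal c := by
  refine totalVariation_le_of_density (absolutelyContinuous_dominating_left μ ν)
    (absolutelyContinuous_dominating_right μ ν) ?_
  filter_upwards [(μ : Measure Ω).rnDeriv_ne_top (dominating μ ν),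
    (ν : Measure Ω).rnDeriv_ne_top (dominating μ ν)] with x h3 h4
  generalize (μ : Measure Ω).rnDeriv (dominating μ ν) x = f at h3 ⊢
  generalize (ν : Measure Ω).rnDeriv (dominating μ ν) x = g at h4 ⊢
  lift f to NNReal using h3
  lift g to NNReal using h4
  simp only [ENNReal.coe_toReal]
  -- Where `g = 0 < f` the quotient is `∞` and the bound is trivial.
  rcases eq_or_ne g 0 with rfl | hg
  · rcases eq_or_ne f 0 with rfl | hf
    · simp
    · rw [ENNReal.coe_zero, ENNReal.div_zero, ENNReal.mul_top (by simpa)]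
      · simp
      · simpa using hf
  have hg' : (0 : ℝ) < g := by positivity
  -- AM-GM for the factors `|f - g| / √g` and `√g`.
  have h5 : |(f : ℝ) - g| ≤ c⁻¹ * (((f : ℝ) - g) ^ 2 / g) + c / 2 * (f + g) := by
    have h6 : c⁻¹ * (|(f : ℝ) - g| ^ 2 / g) + c / 4 * g - |(f : ℝ) - g| =
      c⁻¹ / g * (|(f : ℝ) - g| - c / 2 * g) ^ 2 := by field_simp; ring
    have h7 : 0 ≤ c⁻¹ / g * (|(f : ℝ) - g| - c / 2 * g) ^ 2 := by positivity
    have h8 : 0 ≤ c / 2 * f := by positivity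
    have h9 : 0 ≤ c * g := by positivity
    rw [sq_abs] at h6
    linarith
  refine (ENNReal.ofReal_le_ofReal h5).trans (le_of_eq ?_)
  rw [ENNReal.ofReal_add (by positivity) (by positivity), ENNReal.ofReal_mul (by positivity),
    ENNReal.ofReal_mul (by positivity), ENNReal.ofReal_add (by positivity) (by positivity),
    ENNReal.ofReal_div_of_pos hg', ENNReal.ofReal_coe_nnreal, ENNReal.ofReal_coe_nnreal]

/-- With `s` the separation, `1 - μ i / ν i ≤ s` says `ν ≤ μ + s • ν` on points, hence on all
measurable sets by countability; and `ν A ≤ 1`. -/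
theorem totalVariation_le_separation [Countable Ω] [MeasurableSingletonClass Ω]
    (μ ν : ProbabilityMeasure Ω) : totalVariation μ ν ≤ separation μ ν := by
  rw [totalVariation_comm]
  refine totalVariation_le_of_forall_le_add fun A hA => ?_
  have h1 : ∀ i, (ν : Measure Ω) {i} ≤
      (μ : Measure Ω) {i} + separation μ ν * (ν : Measure Ω) {i} := fun i => by
    rcases eq_or_ne ((ν : Measure Ω) {i}) 0 with h0 | h0
    · simp [h0]
    have h2 : 1 - (μ : Measure Ω) {i} / (ν : Measure Ω) {i} ≤ separation μ ν :=
      le_iSup₂ (f := fun (i : Ω) (_ : (ν : Measure Ω) {i} ≠ 0) =>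
        (1 - (μ : Measure Ω) {i} / (ν : Measure Ω) {i})) i h0
    rw [tsub_le_iff_left] at h2
    calc (ν : Measure Ω) {i} = 1 * (ν : Measure Ω) {i} := (one_mul _).symm
      _ ≤ ((μ : Measure Ω) {i} / (ν : Measure Ω) {i} + separation μ ν) * (ν : Measure Ω) {i} := by
        gcongr
      _ = _ := by rw [add_mul, ENNReal.div_mul_cancel h0 (measure_ne_top _ _)]
  have h2 : (ν : Measure Ω) ≤ μ + separation μ ν • (ν : Measure Ω) := by
    refine Measure.le_iff.2 fun A hA => ?_
    rw [← Measure.tsum_indicator_apply_singleton _ _ hA,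
      ← Measure.tsum_indicator_apply_singleton _ _ hA]
    refine ENNReal.tsum_le_tsum fun i => Set.indicator_le_indicator ?_
    simpa using h1 i
  refine (h2 A).trans ?_
  rw [Measure.add_apply, Measure.smul_apply, smul_eq_mul]
  gcongr
  exact (mul_le_mul_right prob_le_one _).trans (mul_one _).le

end TotalVariation

/-! ### Total variation and stronger distances imply weak convergence -/

section TotalVariationWeak

variable {Ω : Type*} [MetricSpace Ω] [MeasurableSpace Ω] [BorelSpace Ω]

theorem impliesWeak_totalVariation : ImpliesWeak (Ω := Ω) totalVariation := by
  intro μ ν h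
  refine tendsto_of_forall_isOpen_le_liminf' fun G hG => ?_
  have h1 : Tendsto (fun n => (ν : Measure Ω) G - totalVariation (μ n) ν) atTop
      (𝓝 ((ν : Measure Ω) G - 0)) :=
    ENNReal.Tendsto.sub tendsto_const_nhds h (Or.inl (measure_ne_top _ _))
  rw [tsub_zero] at h1
  rw [← h1.liminf_eq]
  refine liminf_le_liminf (Eventually.of_forall fun n => ?_)
  rw [tsub_le_iff_right, totalVariation_comm]
  exact le_add_totalVariation _ _ hG.measurableSet

theorem impliesWeak_hellinger : ImpliesWeak (Ω := Ω) hellinger := by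
  intro μ ν h
  refine impliesWeak_totalVariation μ ν (tendsto_zero_of_forall_le (fun c hc =>
    Eventually.of_forall fun n => totalVariation_le_hellinger_sq (μ n) ν hc) ?_)
  have := ENNReal.Tendsto.pow (n := 2) h
  simpa using this

theorem impliesWeak_relativeEntropy : ImpliesWeak (Ω := Ω) relativeEntropy :=
  impliesWeak_totalVariation.of_forall_le fun _ hc μ ν => totalVariation_le_relativeEntropy μ ν hc

theorem impliesWeak_relativeEntropy_swap :
    ImpliesWeak (Ω := Ω) fun μ ν => relativeEntropy ν μ :=
  impliesWeak_totalVariation.of_forall_le fun _ hc μ ν => by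
    rw [totalVariation_comm]; exact totalVariation_le_relativeEntropy ν μ hc

theorem impliesWeak_chiSquare : ImpliesWeak (Ω := Ω) chiSquare :=
  impliesWeak_totalVariation.of_forall_le fun _ hc μ ν => totalVariation_le_chiSquare μ ν hc

theorem impliesWeak_chiSquare_swap : ImpliesWeak (Ω := Ω) fun μ ν => chiSquare ν μ :=
  impliesWeak_totalVariation.of_forall_le fun _ hc μ ν => by
    rw [totalVariation_comm]; exact totalVariation_le_chiSquare ν μ hc

theorem impliesWeak_separation [Countable Ω] : ImpliesWeak (Ω := Ω) separation :=
  impliesWeak_totalVariation.mono totalVariation_le_separation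

theorem impliesWeak_separation_swap [Countable Ω] :
    ImpliesWeak (Ω := Ω) fun μ ν => separation ν μ :=
  impliesWeak_totalVariation.mono fun μ ν => by
    rw [totalVariation_comm]; exact totalVariation_le_separation ν μ

end TotalVariationWeak

/-! ### The Prokhorov metric -/

section Prokhorov

variable {Ω : Type*} [MetricSpace Ω] [MeasurableSpace Ω]

theorem levyProkhorovEDist_lt_ofReal {μ ν : ProbabilityMeasure Ω} {ε : ℝ}
    (h : levyProkhorovDist (μ : Measure Ω) (ν : Measure Ω) < ε) :
    levyProkhorovEDist (μ : Measure Ω) (ν : Measure Ω) < ENNReal.ofReal ε :=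
  (ENNReal.lt_ofReal_iff_toReal_lt (levyProkhorovEDist_ne_top _ _)).2 h

theorem levyProkhorovDist_nonneg (μ ν : ProbabilityMeasure Ω) :
    0 ≤ levyProkhorovDist (μ : Measure Ω) (ν : Measure Ω) :=
  ENNReal.toReal_nonneg

variable [BorelSpace Ω]

/-- Open and closed thickenings give the same infimum, since the closed one lies in every larger
open one; for probability measures the one-sided condition suffices. -/
theorem prokhorov_eq_levyProkhorovDist (μ ν : ProbabilityMeasure Ω) :
    prokhorov μ ν = ENNReal.ofReal (levyProkhorovDist (μ : Measure Ω) (ν : Measure Ω)) := by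
  rw [prokhorov]
  have hmem : ∀ ε, levyProkhorovDist (μ : Measure Ω) (ν : Measure Ω) < ε →
      ε ∈ {ε : ℝ | 0 < ε ∧ ∀ B : Set Ω, MeasurableSet B →
        (μ : Measure Ω) B ≤ (ν : Measure Ω) (Metric.cthickening ε B) + ENNReal.ofReal ε} := by
    intro ε hε
    have h0 : 0 < ε := (levyProkhorovDist_nonneg μ ν).trans_lt hε
    refine ⟨h0, fun B hB => ?_⟩
    have h1 := left_measure_le_of_levyProkhorovEDist_lt (levyProkhorovEDist_lt_ofReal hε) hB
    rw [ENNReal.toReal_ofReal h0.le] at h1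
    exact h1.trans (add_le_add (measure_mono (Metric.thickening_subset_cthickening _ _)) le_rfl)
  congr 1
  refine le_antisymm ?_ ?_
  · refine le_of_forall_gt_imp_ge_of_dense fun ε hε => csInf_le ⟨0, fun x hx => hx.1.le⟩ (hmem ε hε)
  · refine le_csInf ⟨_, hmem _ (lt_add_one _)⟩ fun ε hε => ?_
    refine levyProkhorovDist_le_of_forall_le _ _ hε.1.le fun δ B hδ hB => (hε.2 B hB).trans ?_
    exact add_le_add (measure_mono (Metric.cthickening_subset_thickening' (hε.1.trans hδ) hδ B))
      (ENNReal.ofReal_le_ofReal hδ.le)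

theorem tendsto_iff_levyProkhorovDist [TopologicalSpace.SeparableSpace Ω]
    {μ : ℕ → ProbabilityMeasure Ω} {ν : ProbabilityMeasure Ω} :
    Tendsto μ atTop (𝓝 ν) ↔
      Tendsto (fun n => levyProkhorovDist (μ n : Measure Ω) (ν : Measure Ω)) atTop (𝓝 0) := by
  rw [(LevyProkhorov.probabilityMeasureHomeomorph (Ω := Ω)).isInducing.tendsto_nhds_iff,
    tendsto_iff_dist_tendsto_zero]
  rfl

theorem metrizesWeak_prokhorov [TopologicalSpace.SeparableSpace Ω] :
    MetrizesWeak (Ω := Ω) prokhorov := by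
  refine MetrizesWeak.of_metrizesWeakAt ?_ ?_ ?_ ?_
  · simp [prokhorov_eq_levyProkhorovDist]
  · intro μ ν
    rw [prokhorov_eq_levyProkhorovDist, prokhorov_eq_levyProkhorovDist, levyProkhorovDist_comm]
  · intro μ ν κ
    simp only [prokhorov_eq_levyProkhorovDist]
    rw [← ENNReal.ofReal_add (levyProkhorovDist_nonneg _ _) (levyProkhorovDist_nonneg _ _)]
    exact ENNReal.ofReal_le_ofReal (levyProkhorovDist_triangle _ _ _)
  · intro ν μ
    simp only [prokhorov_eq_levyProkhorovDist]
    rw [tendsto_iff_levyProkhorovDist,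
      ← ENNReal.tendsto_toReal_zero_iff (fun n => ENNReal.ofReal_ne_top)]
    simp only [ENNReal.toReal_ofReal (levyProkhorovDist_nonneg _ _)]

end Prokhorov

/-! ### The Wasserstein metric -/

section Wasserstein

variable {Ω : Type*} [MetricSpace Ω] [MeasurableSpace Ω]

theorem le_wasserstein {μ ν : ProbabilityMeasure Ω} {h : Ω → ℝ}
    (hl : ∀ x y, |h x - h y| ≤ dist x y) (hμ : Integrable h (μ : Measure Ω))
    (hν : Integrable h (ν : Measure Ω)) :
    ENNReal.ofReal |∫ x, h x ∂(μ : Measure Ω) - ∫ x, h x ∂(ν : Measure Ω)| ≤ wasserstein μ ν := by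
  rw [wasserstein]
  exact le_iSup_of_le h (le_iSup_of_le hl (le_iSup_of_le hμ (le_iSup_of_le hν le_rfl)))

theorem wasserstein_le {μ ν : ProbabilityMeasure Ω} {s : ℝ≥0∞}
    (H : ∀ h : Ω → ℝ, (∀ x y, |h x - h y| ≤ dist x y) →
      ENNReal.ofReal |∫ x, h x ∂(μ : Measure Ω) - ∫ x, h x ∂(ν : Measure Ω)| ≤ s) :
    wasserstein μ ν ≤ s :=
  iSup_le fun h => iSup_le fun hl => iSup_le fun _ => iSup_le fun _ => H h hl

theorem wasserstein_comm (μ ν : ProbabilityMeasure Ω) : wasserstein μ ν = wasserstein ν μ := by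
  refine le_antisymm ?_ ?_ <;>
  · refine iSup_le fun h => iSup_le fun hl => iSup_le fun h1 => iSup_le fun h2 => ?_
    rw [abs_sub_comm]
    exact le_wasserstein hl h2 h1

theorem continuous_of_abs_sub_le_dist {X : Type*} [MetricSpace X] {h : X → ℝ}
    (hl : ∀ x y, |h x - h y| ≤ dist x y) :
    Continuous h :=
  (LipschitzWith.of_dist_le_mul (K := 1) fun x y => by simpa [Real.dist_eq] using hl x y).continuous

variable [BorelSpace Ω]

theorem impliesWeak_wasserstein : ImpliesWeak (Ω := Ω) wasserstein := by
  intro μ ν hW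
  rw [tendsto_iff_forall_lipschitz_integral_tendsto]
  rintro f ⟨C, hC⟩ ⟨L, hL⟩
  have hint : ∀ ρ : ProbabilityMeasure Ω, Integrable f (ρ : Measure Ω) := fun ρ =>
    BoundedContinuousFunction.integrable (ρ : Measure Ω) ⟨⟨f, hL.continuous⟩, C, hC⟩
  -- Dividing by `L + 1` makes `f` 1-Lipschitz and avoids division by zero when `L = 0`.
  have hL1 : (0 : ℝ) < L + 1 := by positivity
  have hl : ∀ x y, |(L + 1 : ℝ)⁻¹ * f x - (L + 1 : ℝ)⁻¹ * f y| ≤ dist x y := fun x y => by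
    rw [← mul_sub, abs_mul, abs_of_pos (inv_pos.2 hL1), inv_mul_le_iff₀ hL1, ← Real.dist_eq]
    exact (hL.dist_le_mul x y).trans
      (mul_le_mul_of_nonneg_right (by linarith) dist_nonneg)
  have h1 : Tendsto (fun n => ENNReal.ofReal |∫ x, (L + 1 : ℝ)⁻¹ * f x ∂(μ n : Measure Ω) -
      ∫ x, (L + 1 : ℝ)⁻¹ * f x ∂(ν : Measure Ω)|) atTop (𝓝 0) :=
    tendsto_of_tendsto_of_tendsto_of_le_of_le tendsto_const_nhds hW (fun _ => zero_le)
      fun n => le_wasserstein hl ((hint _).const_mul _) ((hint _).const_mul _)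
  rw [← ENNReal.tendsto_toReal_zero_iff (fun n => ENNReal.ofReal_ne_top)] at h1
  simp only [ENNReal.toReal_ofReal (abs_nonneg _), integral_const_mul, ← mul_sub] at h1
  rw [tendsto_zero_iff_abs_tendsto_zero] at h1
  have h2 : Tendsto (fun n => (L + 1 : ℝ)⁻¹ * (∫ x, f x ∂(μ n : Measure Ω) -
      ∫ x, f x ∂(ν : Measure Ω))) atTop (𝓝 0) := by
    rw [tendsto_zero_iff_abs_tendsto_zero]
    simpa [Function.comp_def] using h1
  have h3 := h2.const_mul (L + 1 : ℝ)
  simp only [mul_inv_cancel_left₀ hL1.ne', mul_zero] at h3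
  exact tendsto_sub_nhds_zero_iff.1 h3

variable [BoundedSpace Ω]

theorem integrable_of_abs_sub_le_dist {h : Ω → ℝ} (hl : ∀ x y, |h x - h y| ≤ dist x y)
    (μ : ProbabilityMeasure Ω) : Integrable h (μ : Measure Ω) :=
  BoundedContinuousFunction.integrable (μ : Measure Ω)
    ⟨⟨h, continuous_of_abs_sub_le_dist hl⟩, Metric.diam (Set.univ : Set Ω), fun x y =>
      (hl x y).trans (Metric.dist_le_diam_of_mem (Bornology.IsBounded.all _)
        (Set.mem_univ x) (Set.mem_univ y))⟩

theorem wasserstein_triangle (μ ν κ : ProbabilityMeasure Ω) :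
    wasserstein μ κ ≤ wasserstein μ ν + wasserstein ν κ := by
  refine wasserstein_le fun h hl => ?_
  refine le_trans ?_ (add_le_add
    (le_wasserstein hl (integrable_of_abs_sub_le_dist hl μ) (integrable_of_abs_sub_le_dist hl ν))
    (le_wasserstein hl (integrable_of_abs_sub_le_dist hl ν) (integrable_of_abs_sub_le_dist hl κ)))
  rw [← ENNReal.ofReal_add (abs_nonneg _) (abs_nonneg _)]
  exact ENNReal.ofReal_le_ofReal (abs_sub_le _ _ _)

/-- Layer-cake argument for a nonnegative shift `g` of `h`. The `μ`-mass of `{t ≤ g}` is at most the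
`ν`-mass of its `ε`-thickening plus `ε`, and that thickening lies in `{t ≤ g + ε}` because `g` is
1-Lipschitz. Integrating over `0 < t ≤ ‖g‖ ≤ 2 * D` costs `ε + 2 * D * ε`. -/
theorem integral_le_integral_add_of_levyProkhorovDist_lt {μ ν : ProbabilityMeasure Ω} {ε : ℝ}
    (hε : levyProkhorovDist (μ : Measure Ω) (ν : Measure Ω) < ε)
    {h : Ω → ℝ} (hl : ∀ x y, |h x - h y| ≤ dist x y) :
    ∫ x, h x ∂(μ : Measure Ω) ≤ ∫ x, h x ∂(ν : Measure Ω) +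
      ε * (1 + 2 * Metric.diam (Set.univ : Set Ω)) := by
  set D := Metric.diam (Set.univ : Set Ω)
  have hD : 0 ≤ D := Metric.diam_nonneg
  have h0 : 0 < ε := (levyProkhorovDist_nonneg μ ν).trans_lt hε
  obtain ⟨x₀⟩ : Nonempty Ω := nonempty_of_isProbabilityMeasure (μ : Measure Ω)
  have hdist : ∀ x y : Ω, |h x - h y| ≤ D := fun x y => (hl x y).trans
    (Metric.dist_le_diam_of_mem (Bornology.IsBounded.all _) (Set.mem_univ x) (Set.mem_univ y))
  have hg : ∀ c : ℝ, ∃ g : BoundedContinuousFunction Ω ℝ, ∀ x, g x = h x + c := fun c =>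
    ⟨⟨⟨fun x => h x + c, (continuous_of_abs_sub_le_dist hl).add continuous_const⟩, D,
      fun x y => by simpa [Real.dist_eq] using hdist x y⟩, fun x => rfl⟩
  -- Since `h` varies by at most `D`, this shift puts `g` in `[0, 2 * D]`.
  obtain ⟨g, hg1⟩ := hg (D - h x₀)
  obtain ⟨g', hg2⟩ := hg (D - h x₀ + ε)
  have hg0 : ∀ x, 0 ≤ g x := fun x => by rw [hg1]; linarith [(abs_le.1 (hdist x x₀)).1]
  have hgg : ∀ x, g' x = g x + ε := fun x => by rw [hg1, hg2]; ring
  have hgn : ‖g‖ ≤ 2 * D := by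
    rw [BoundedContinuousFunction.norm_le (by positivity)]
    intro x
    rw [Real.norm_eq_abs, abs_of_nonneg (hg0 x), hg1]
    linarith [(abs_le.1 (hdist x x₀)).2]
  have hgn' : ‖g‖ ≤ ‖g'‖ := by
    rw [BoundedContinuousFunction.norm_le (norm_nonneg _)]
    intro x
    refine le_trans ?_ (g'.norm_coe_le_norm x)
    rw [hgg, Real.norm_eq_abs, Real.norm_eq_abs, abs_of_nonneg (hg0 x),
      abs_of_nonneg (by linarith [hg0 x])]
    linarith
  have h1 := BoundedContinuousFunction.integral_le_of_levyProkhorovEDist_lt (μ : Measure Ω)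
    (ν : Measure Ω) h0 (levyProkhorovEDist_lt_ofReal hε) g (Eventually.of_forall hg0)
  have h2 := BoundedContinuousFunction.integral_eq_integral_meas_le g' (ν : Measure Ω)
    (Eventually.of_forall fun x => by
      simp only [Pi.zero_apply]; rw [hgg]; linarith [hg0 x])
  have hanti : Antitone fun t : ℝ => (ν : Measure Ω).real {a | t ≤ g' a} := fun s t hst =>
    measureReal_mono fun a ha => hst.trans ha
  have hint : IntegrableOn (fun t : ℝ => (ν : Measure Ω).real {a | t ≤ g' a})
      (Set.Ioc 0 ‖g'‖) :=
    Measure.integrableOn_of_bounded (M := 1) (by simp) hanti.measurable.aestronglyMeasurable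
      (Eventually.of_forall fun t => by
        rw [Real.norm_eq_abs, abs_of_nonneg measureReal_nonneg]; exact measureReal_le_one)
  have h3 : ∫ t in Set.Ioc 0 ‖g‖, (ν : Measure Ω).real (Metric.thickening ε {a | t ≤ g a}) ≤
      ∫ t in Set.Ioc 0 ‖g'‖, (ν : Measure Ω).real {a | t ≤ g' a} := by
    have hsub : Set.Ioc 0 ‖g‖ ⊆ Set.Ioc 0 ‖g'‖ := Set.Ioc_subset_Ioc_right hgn'
    refine le_trans (integral_mono_of_nonneg (Eventually.of_forall fun t => measureReal_nonneg)
      (hint.mono_set hsub) (Eventually.of_forall fun t => ?_))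
      (setIntegral_mono_set hint (Eventually.of_forall fun t => measureReal_nonneg)
        hsub.eventuallyLE)
    refine measureReal_mono fun a ha => ?_
    obtain ⟨b, hb, hab⟩ := Metric.mem_thickening_iff.1 ha
    have hb' : t ≤ g b := hb
    have h5 := (abs_le.1 (hl a b)).1
    change t ≤ g' a
    rw [hg2]
    rw [hg1] at hb'
    linarith
  have h4 : ∀ (ρ : ProbabilityMeasure Ω) (c : ℝ) (f : BoundedContinuousFunction Ω ℝ),
      (∀ x, f x = h x + c) → ∫ x, f x ∂(ρ : Measure Ω) = ∫ x, h x ∂(ρ : Measure Ω) + c := by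
    intro ρ c f hf
    simp_rw [hf]
    rw [integral_add (integrable_of_abs_sub_le_dist hl ρ) (integrable_const _)]
    simp
  rw [h4 μ _ g hg1] at h1
  rw [h4 ν _ g' hg2] at h2
  have h6 : ε * ‖g‖ ≤ ε * (2 * D) := mul_le_mul_of_nonneg_left hgn h0.le
  linarith

theorem wasserstein_le_of_levyProkhorovDist_lt {μ ν : ProbabilityMeasure Ω} {ε : ℝ}
    (hε : levyProkhorovDist (μ : Measure Ω) (ν : Measure Ω) < ε) :
    wasserstein μ ν ≤ ENNReal.ofReal (ε * (1 + 2 * Metric.diam (Set.univ : Set Ω))) := by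
  refine wasserstein_le fun h hl => ENNReal.ofReal_le_ofReal (abs_le.2 ⟨?_, ?_⟩)
  · have h1 := integral_le_integral_add_of_levyProkhorovDist_lt
      (by rwa [levyProkhorovDist_comm] at hε) hl
    linarith
  · have h1 := integral_le_integral_add_of_levyProkhorovDist_lt hε hl
    linarith

theorem metrizesWeak_wasserstein [TopologicalSpace.SeparableSpace Ω] :
    MetrizesWeak (Ω := Ω) wasserstein := by
  refine MetrizesWeak.of_metrizesWeakAt (fun μ ν => ?_) wasserstein_comm wasserstein_triangle
    (impliesWeak_wasserstein.metrizesWeakAt fun μ ν h => ?_)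
  · exact ((wasserstein_le_of_levyProkhorovDist_lt (lt_add_one _)).trans_lt
      ENNReal.ofReal_lt_top).ne
  -- The extra `1 / (n + 1)` provides the strict inequality that the estimate requires.
  · have h1 := ((tendsto_iff_levyProkhorovDist.1 h).add
      (tendsto_one_div_add_atTop_nhds_zero_nat (𝕜 := ℝ))).mul_const
      (1 + 2 * Metric.diam (Set.univ : Set Ω))
    have h2 := ENNReal.tendsto_ofReal h1
    rw [add_zero, zero_mul, ENNReal.ofReal_zero] at h2
    refine tendsto_of_tendsto_of_tendsto_of_le_of_le tendsto_const_nhds h2 (fun _ => zero_le)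
      fun n => wasserstein_le_of_levyProkhorovDist_lt (lt_add_of_pos_right _ (by positivity))

end Wasserstein

/-! ### Total variation and Hellinger on finite spaces -/

section FiniteSpaces

variable {Ω : Type*} [MetricSpace Ω] [MeasurableSpace Ω] [BorelSpace Ω] [Finite Ω]

theorem tendsto_measureReal_of_finite {μ : ℕ → ProbabilityMeasure Ω} {ν : ProbabilityMeasure Ω}
    (h : Tendsto μ atTop (𝓝 ν)) (A : Set Ω) :
    Tendsto (fun n => (μ n : Measure Ω).real A) atTop (𝓝 ((ν : Measure Ω).real A)) :=
  (NNReal.tendsto_coe.2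
    (ProbabilityMeasure.tendsto_measure_of_isClopen_of_tendsto h (isClopen_discrete A)))

theorem metrizesWeak_totalVariation : MetrizesWeak (Ω := Ω) totalVariation := by
  refine MetrizesWeak.of_metrizesWeakAt totalVariation_ne_top totalVariation_comm
    totalVariation_triangle (impliesWeak_totalVariation.metrizesWeakAt fun μ ν h => ?_)
  rw [ENNReal.tendsto_nhds_zero]
  intro ε hε
  have h1 : ∀ A : Set Ω, ∀ᶠ n in atTop,
      ENNReal.ofReal |(μ n : Measure Ω).real A - (ν : Measure Ω).real A| ≤ ε := fun A => by
    have h2 := ENNReal.tendsto_ofReal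
      (((tendsto_measureReal_of_finite h A).sub_const ((ν : Measure Ω).real A)).abs)
    rw [sub_self, abs_zero, ENNReal.ofReal_zero] at h2
    exact ENNReal.tendsto_nhds_zero.1 h2 ε hε
  -- There are only finitely many sets `A`, so setwise convergence is uniform.
  filter_upwards [eventually_all.2 h1] with n hn
  exact iSup₂_le fun A _ => hn A

/-- The square roots of the point masses. -/
noncomputable def sqrtMass [Fintype Ω] (μ : ProbabilityMeasure Ω) : EuclideanSpace ℝ Ω :=
  WithLp.toLp 2 fun i => √((μ : Measure Ω).real {i})

theorem toReal_rnDeriv_mul_singleton {μ ρ : Measure Ω} [IsFiniteMeasure μ] [IsFiniteMeasure ρ]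
    (h : μ ≪ ρ) (i : Ω) : (μ.rnDeriv ρ i).toReal * ρ.real {i} = μ.real {i} := by
  rw [Measure.real, Measure.real, ← ENNReal.toReal_mul, ← Measure.setLIntegral_rnDeriv h {i},
    lintegral_singleton]

/-- The mass of the dominating measure at `i` is absorbed into the square roots of the densities.
Symmetry and the triangle inequality are thus inherited from Euclidean space. -/
theorem hellinger_eq_dist_sqrtMass [Fintype Ω] (μ ν : ProbabilityMeasure Ω) :
    hellinger μ ν = ENNReal.ofReal (dist (sqrtMass μ) (sqrtMass ν)) := by
  rw [hellinger, lintegral_fintype, EuclideanSpace.dist_eq, Real.sqrt_eq_rpow,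
    ← ENNReal.ofReal_rpow_of_nonneg (by positivity) (by positivity),
    ENNReal.ofReal_sum_of_nonneg fun i _ => by positivity]
  congr 1
  refine Finset.sum_congr rfl fun i _ => ?_
  rw [← ofReal_measureReal (μ := dominating μ ν), ← ENNReal.ofReal_mul (by positivity)]
  congr 1
  simp only [sqrtMass]
  rw [← toReal_rnDeriv_mul_singleton (absolutelyContinuous_dominating_left μ ν) i,
    ← toReal_rnDeriv_mul_singleton (absolutelyContinuous_dominating_right μ ν) i,
    Real.sqrt_mul ENNReal.toReal_nonneg, Real.sqrt_mul ENNReal.toReal_nonneg, Real.dist_eq,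
    sq_abs, ← sub_mul, mul_pow, Real.sq_sqrt measureReal_nonneg]

theorem metrizesWeak_hellinger : MetrizesWeak (Ω := Ω) hellinger := by
  have := Fintype.ofFinite Ω
  refine MetrizesWeak.of_metrizesWeakAt ?_ ?_ ?_
    (impliesWeak_hellinger.metrizesWeakAt fun μ ν h => ?_)
  · simp [hellinger_eq_dist_sqrtMass]
  · intro μ ν
    rw [hellinger_eq_dist_sqrtMass, hellinger_eq_dist_sqrtMass, dist_comm]
  · intro μ ν κ
    simp only [hellinger_eq_dist_sqrtMass]
    rw [← ENNReal.ofReal_add dist_nonneg dist_nonneg]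
    exact ENNReal.ofReal_le_ofReal (dist_triangle _ _ _)
  · have h1 : Tendsto (fun n => sqrtMass (μ n)) atTop (𝓝 (sqrtMass ν)) :=
      ((PiLp.continuous_toLp 2 _).tendsto _).comp
        (tendsto_pi_nhds.2 fun i => (tendsto_measureReal_of_finite h {i}).sqrt)
    have h2 := ENNReal.tendsto_ofReal (tendsto_iff_dist_tendsto_zero.1 h1)
    rw [ENNReal.ofReal_zero] at h2
    simpa only [hellinger_eq_dist_sqrtMass] using h2

end FiniteSpaces

/-! ### The Lévy metric and distribution functions -/

section Real

/-- The set whose infimum is the Lévy distance. -/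
def levySet (μ ν : ProbabilityMeasure ℝ) : Set ℝ :=
  {ε : ℝ | 0 < ε ∧ ∀ x : ℝ,
    cdf (ν : Measure ℝ) (x - ε) - ε ≤ cdf (μ : Measure ℝ) x ∧
    cdf (μ : Measure ℝ) x ≤ cdf (ν : Measure ℝ) (x + ε) + ε}

theorem levy_eq_ofReal_sInf (μ ν : ProbabilityMeasure ℝ) :
    levy μ ν = ENNReal.ofReal (sInf (levySet μ ν)) := rfl

theorem bddBelow_levySet (μ ν : ProbabilityMeasure ℝ) : BddBelow (levySet μ ν) :=
  ⟨0, fun _ h => h.1.le⟩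

theorem one_mem_levySet (μ ν : ProbabilityMeasure ℝ) : 1 ∈ levySet μ ν :=
  ⟨one_pos, fun x => by
    have h1 := cdf_le_one (ν : Measure ℝ) (x - 1)
    have h2 := cdf_nonneg (μ : Measure ℝ) x
    have h3 := cdf_le_one (μ : Measure ℝ) x
    have h4 := cdf_nonneg (ν : Measure ℝ) (x + 1)
    constructor <;> linarith⟩

theorem levySet_mono {μ ν : ProbabilityMeasure ℝ} {ε δ : ℝ} (h : ε ∈ levySet μ ν) (hεδ : ε ≤ δ) :
    δ ∈ levySet μ ν := by
  refine ⟨h.1.trans_le hεδ, fun x => ?_⟩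
  have h1 := monotone_cdf (ν : Measure ℝ) (show x - δ ≤ x - ε by linarith)
  have h2 := monotone_cdf (ν : Measure ℝ) (show x + ε ≤ x + δ by linarith)
  have h3 := h.2 x
  constructor <;> linarith

/-- Each inequality is the other one evaluated at a point shifted by `ε`. -/
theorem levySet_comm_subset (μ ν : ProbabilityMeasure ℝ) : levySet μ ν ⊆ levySet ν μ := by
  refine fun ε h => ⟨h.1, fun x => ?_⟩
  have h1 := (h.2 (x - ε)).2
  have h2 := (h.2 (x + ε)).1
  rw [sub_add_cancel] at h1
  rw [add_sub_cancel_right] at h2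
  constructor <;> linarith

theorem add_mem_levySet {μ ν κ : ProbabilityMeasure ℝ} {ε δ : ℝ} (h : ε ∈ levySet μ ν)
    (h' : δ ∈ levySet ν κ) : ε + δ ∈ levySet μ κ := by
  refine ⟨add_pos h.1 h'.1, fun x => ?_⟩
  have h1 := h.2 x
  have h2 := (h'.2 (x - ε)).1
  have h3 := (h'.2 (x + ε)).2
  rw [sub_sub] at h2
  rw [add_assoc] at h3
  constructor <;> linarith

theorem mem_levySet_of_levy_lt {μ ν : ProbabilityMeasure ℝ} {ε : ℝ}
    (h : levy μ ν < ENNReal.ofReal ε) : ε ∈ levySet μ ν := by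
  rw [levy_eq_ofReal_sInf] at h
  obtain ⟨δ, hδ, hδε⟩ := exists_lt_of_csInf_lt ⟨1, one_mem_levySet μ ν⟩
    (ENNReal.ofReal_lt_ofReal_iff'.1 h).1
  exact levySet_mono hδ hδε.le

theorem levy_comm (μ ν : ProbabilityMeasure ℝ) : levy μ ν = levy ν μ := by
  rw [levy_eq_ofReal_sInf, levy_eq_ofReal_sInf,
    (levySet_comm_subset μ ν).antisymm (levySet_comm_subset ν μ)]

theorem levy_triangle (μ ν κ : ProbabilityMeasure ℝ) : levy μ κ ≤ levy μ ν + levy ν κ := by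
  have hnn : ∀ μ ν : ProbabilityMeasure ℝ, 0 ≤ sInf (levySet μ ν) := fun μ ν =>
    Real.sInf_nonneg fun _ h => h.1.le
  simp only [levy_eq_ofReal_sInf]
  rw [← ENNReal.ofReal_add (hnn _ _) (hnn _ _)]
  refine ENNReal.ofReal_le_ofReal (le_of_forall_pos_le_add fun ε hε => ?_)
  obtain ⟨a, ha, ha'⟩ := Real.lt_sInf_add_pos ⟨1, one_mem_levySet μ ν⟩ (half_pos hε)
  obtain ⟨b, hb, hb'⟩ := Real.lt_sInf_add_pos ⟨1, one_mem_levySet ν κ⟩ (half_pos hε)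
  refine (csInf_le (bddBelow_levySet μ κ) (add_mem_levySet ha hb)).trans ?_
  linarith

/-- Only the half-lines `Iic x` are tested; their `ε`-thickenings lie in `Iic (x + ε)`. -/
theorem levy_le_prokhorov (μ ν : ProbabilityMeasure ℝ) : levy μ ν ≤ prokhorov μ ν := by
  rw [prokhorov_eq_levyProkhorovDist]
  refine ENNReal.ofReal_le_ofReal (le_of_forall_gt_imp_ge_of_dense fun ε hε =>
    csInf_le (bddBelow_levySet μ ν) ?_)
  have h0 : 0 < ε := (levyProkhorovDist_nonneg μ ν).trans_lt hε
  have hthick : ∀ x : ℝ, Metric.thickening ε (Set.Iic x) ⊆ Set.Iic (x + ε) := fun x y hy => by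
    obtain ⟨z, hz, hyz⟩ := Metric.mem_thickening_iff.1 hy
    have h1 := (abs_lt.1 (Real.dist_eq y z ▸ hyz)).2
    have h2 : z ≤ x := hz
    change y ≤ x + ε
    linarith
  have hlt := levyProkhorovEDist_lt_ofReal hε
  have key : ∀ (ρ σ : ProbabilityMeasure ℝ) (x : ℝ),
      (ρ : Measure ℝ) (Set.Iic x) ≤ (σ : Measure ℝ)
        (Metric.thickening (ENNReal.ofReal ε).toReal (Set.Iic x)) + ENNReal.ofReal ε →
      cdf (ρ : Measure ℝ) x ≤ cdf (σ : Measure ℝ) (x + ε) + ε := fun ρ σ x h => by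
    rw [ENNReal.toReal_ofReal h0.le] at h
    replace h := h.trans (add_le_add (measure_mono (hthick x)) le_rfl)
    rw [← ofReal_cdf, ← ofReal_cdf, ← ENNReal.ofReal_add (cdf_nonneg _ _) h0.le] at h
    exact (ENNReal.ofReal_le_ofReal_iff (add_nonneg (cdf_nonneg _ _) h0.le)).1 h
  refine ⟨h0, fun x => ⟨?_, ?_⟩⟩
  · have := key ν μ (x - ε)
      (right_measure_le_of_levyProkhorovEDist_lt hlt measurableSet_Iic)
    rw [sub_add_cancel] at this
    linarith
  · exact key μ ν x (left_measure_le_of_levyProkhorovEDist_lt hlt measurableSet_Iic)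

theorem eventually_mem_levySet {μ : ℕ → ProbabilityMeasure ℝ} {ν : ProbabilityMeasure ℝ}
    (h : Tendsto (fun n => levy (μ n) ν) atTop (𝓝 0)) {ε : ℝ} (hε : 0 < ε) :
    ∀ᶠ n in atTop, ε ∈ levySet (μ n) ν :=
  (h.eventually_lt_const (ENNReal.ofReal_pos.2 hε)).mono fun _ => mem_levySet_of_levy_lt

theorem tendsto_cdf_of_tendsto_levy {μ : ℕ → ProbabilityMeasure ℝ} {ν : ProbabilityMeasure ℝ}
    (h : Tendsto (fun n => levy (μ n) ν) atTop (𝓝 0)) {x : ℝ}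
    (hx : ContinuousAt (cdf (ν : Measure ℝ)) x) :
    Tendsto (fun n => cdf (μ n : Measure ℝ) x) atTop (𝓝 (cdf (ν : Measure ℝ) x)) := by
  rw [Metric.tendsto_nhds]
  intro η hη
  obtain ⟨δ, hδ, hδ'⟩ := Metric.continuousAt_iff.1 hx (η / 2) (half_pos hη)
  have hε : 0 < min (δ / 2) (η / 2) := lt_min (half_pos hδ) (half_pos hη)
  filter_upwards [eventually_mem_levySet h hε] with n hn
  generalize hε' : min (δ / 2) (η / 2) = ε at *
  have h1 : ε ≤ δ / 2 := hε' ▸ min_le_left _ _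
  have h2 : ε ≤ η / 2 := hε' ▸ min_le_right _ _
  have h3 := @hδ' (x - ε) (by rw [Real.dist_eq, abs_lt]; constructor <;> linarith)
  have h4 := @hδ' (x + ε) (by rw [Real.dist_eq, abs_lt]; constructor <;> linarith)
  rw [Real.dist_eq, abs_lt] at h3 h4 ⊢
  have h5 := hn.2 x
  constructor <;> linarith

theorem measureReal_Ioc_eq_cdf_sub (μ : ProbabilityMeasure ℝ) {a b : ℝ} (hab : a ≤ b) :
    (μ : Measure ℝ).real (Set.Ioc a b) = cdf (μ : Measure ℝ) b - cdf (μ : Measure ℝ) a := by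
  rw [cdf_eq_real, cdf_eq_real, ← Set.Iic_sdiff_Iic,
    measureReal_sdiff (Set.Iic_subset_Iic.2 hab) measurableSet_Iic]

/-- Convergence of the distribution functions at the continuity points of the limit implies weak
convergence. -/
theorem tendsto_of_tendsto_cdf {μ : ℕ → ProbabilityMeasure ℝ} {ν : ProbabilityMeasure ℝ}
    (h : ∀ x, ContinuousAt (cdf (ν : Measure ℝ)) x →
      Tendsto (fun n => cdf (μ n : Measure ℝ) x) atTop (𝓝 (cdf (ν : Measure ℝ) x))) :
    Tendsto μ atTop (𝓝 ν) := by
  set C : Set ℝ := {x | ContinuousAt (cdf (ν : Measure ℝ)) x}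
  have hdense : Dense C := by
    have h1 : C = {x | ¬ContinuousAt (cdf (ν : Measure ℝ)) x}ᶜ := by ext x; simp [C]
    rw [h1]
    exact (monotone_cdf (ν : Measure ℝ)).countable_not_continuousAt.dense_compl ℝ
  -- Half-open intervals with endpoints in the dense set `C` form a π-system containing arbitrarily
  -- small neighbourhoods of each point, and their masses converge.
  refine (isPiSystem_Ioc_mem C C).tendsto_probabilityMeasure_of_tendsto_of_mem ?_ ?_ ?_
  · rintro _ ⟨a, _, b, _, _, rfl⟩
    exact measurableSet_Ioc
  · intro u hu x hx
    obtain ⟨r, hr, hru⟩ := Metric.isOpen_iff.1 hu x hx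
    obtain ⟨a, ha, ha1, ha2⟩ := hdense.exists_between (show x - r < x by linarith)
    obtain ⟨b, hb, hb1, hb2⟩ := hdense.exists_between (show x < x + r by linarith)
    refine ⟨_, ⟨a, ha, b, hb, ha2.trans hb1, rfl⟩, Ioc_mem_nhds ha2 hb1, fun y hy => hru ?_⟩
    rw [Metric.mem_ball, Real.dist_eq, abs_lt]
    constructor <;> linarith [hy.1, hy.2]
  · rintro _ ⟨a, ha, b, hb, hab, rfl⟩
    have h1 : Tendsto (fun n => (μ n : Measure ℝ).real (Set.Ioc a b)) atTop
        (𝓝 ((ν : Measure ℝ).real (Set.Ioc a b))) := by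
      simp only [measureReal_Ioc_eq_cdf_sub _ hab.le]
      exact (h b hb).sub (h a ha)
    exact NNReal.tendsto_coe.1 h1

theorem impliesWeak_levy : ImpliesWeak levy :=
  fun _ _ h => tendsto_of_tendsto_cdf fun _ hx => tendsto_cdf_of_tendsto_levy h hx

theorem tendsto_levy_of_tendsto {μ : ℕ → ProbabilityMeasure ℝ} {ν : ProbabilityMeasure ℝ}
    (h : Tendsto μ atTop (𝓝 ν)) : Tendsto (fun n => levy (μ n) ν) atTop (𝓝 0) := by
  have h1 := ENNReal.tendsto_ofReal (tendsto_iff_levyProkhorovDist.1 h)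
  rw [ENNReal.ofReal_zero] at h1
  refine tendsto_of_tendsto_of_tendsto_of_le_of_le tendsto_const_nhds h1 (fun _ => zero_le)
    fun n => ?_
  rw [← prokhorov_eq_levyProkhorovDist]
  exact levy_le_prokhorov _ _

theorem metrizesWeak_levy : MetrizesWeak levy :=
  MetrizesWeak.of_metrizesWeakAt (fun _ _ => ENNReal.ofReal_ne_top) levy_comm levy_triangle
    (impliesWeak_levy.metrizesWeakAt fun _ _ => tendsto_levy_of_tendsto)

/-! ### Kolmogorov distance and discrepancy -/

theorem le_kolmogorov (μ ν : ProbabilityMeasure ℝ) (x : ℝ) :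
    ENNReal.ofReal |cdf (μ : Measure ℝ) x - cdf (ν : Measure ℝ) x| ≤ kolmogorov μ ν :=
  le_iSup (fun x : ℝ => ENNReal.ofReal |cdf (μ : Measure ℝ) x - cdf (ν : Measure ℝ) x|) x

theorem kolmogorov_ne_top (μ ν : ProbabilityMeasure ℝ) : kolmogorov μ ν ≠ ∞ := by
  refine ((iSup_le fun x => ENNReal.ofReal_le_ofReal (abs_le.2 ⟨?_, ?_⟩)).trans_lt
    (ENNReal.ofReal_lt_top (r := 1))).ne <;>
  linarith [cdf_le_one (ν : Measure ℝ) x, cdf_nonneg (μ : Measure ℝ) x,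
    cdf_le_one (μ : Measure ℝ) x, cdf_nonneg (ν : Measure ℝ) x]

theorem abs_cdf_sub_le_kolmogorov (μ ν : ProbabilityMeasure ℝ) (x : ℝ) :
    |cdf (μ : Measure ℝ) x - cdf (ν : Measure ℝ) x| ≤ (kolmogorov μ ν).toReal :=
  (ENNReal.ofReal_le_iff_le_toReal (kolmogorov_ne_top μ ν)).1 (le_kolmogorov μ ν x)

theorem levy_le_kolmogorov (μ ν : ProbabilityMeasure ℝ) : levy μ ν ≤ kolmogorov μ ν := by
  rw [← ENNReal.ofReal_toReal (kolmogorov_ne_top μ ν)]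
  refine ENNReal.ofReal_le_ofReal (le_of_forall_gt_imp_ge_of_dense fun ε hε =>
    csInf_le (bddBelow_levySet μ ν) ?_)
  have h0 : 0 < ε := ENNReal.toReal_nonneg.trans_lt hε
  refine ⟨h0, fun x => ?_⟩
  have h1 := abs_le.1 ((abs_cdf_sub_le_kolmogorov μ ν x).trans hε.le)
  have h2 := monotone_cdf (ν : Measure ℝ) (show x - ε ≤ x by linarith)
  have h3 := monotone_cdf (ν : Measure ℝ) (show x ≤ x + ε by linarith)
  constructor <;> linarith

theorem impliesWeak_kolmogorov : ImpliesWeak kolmogorov :=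
  impliesWeak_levy.mono levy_le_kolmogorov

/-- A closed ball is `[x - r, x + r]`, of mass `F (x + r)` minus the left limit of `F` at `x - r`;
the Kolmogorov bound passes to left limits. -/
theorem discrepancy_le_two_mul_kolmogorov (μ ν : ProbabilityMeasure ℝ) :
    discrepancy μ ν ≤ 2 * kolmogorov μ ν := by
  refine iSup_le fun x => iSup_le fun r => iSup_le fun hr => ?_
  have key : ∀ ρ : ProbabilityMeasure ℝ, (ρ : Measure ℝ).real (Metric.closedBall x r) =
      cdf (ρ : Measure ℝ) (x + r) - Function.leftLim (cdf (ρ : Measure ℝ)) (x - r) := fun ρ => by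
    have h1 : Function.leftLim (cdf (ρ : Measure ℝ)) (x - r) ≤ cdf (ρ : Measure ℝ) (x + r) :=
      (monotone_cdf (ρ : Measure ℝ)).leftLim_le (by linarith)
    rw [Real.closedBall_eq_Icc, Measure.real]
    nth_rw 1 [← measure_cdf (ρ : Measure ℝ)]
    rw [StieltjesFunction.measure_Icc, ENNReal.toReal_ofReal (by linarith)]
  have hlim : |Function.leftLim (cdf (μ : Measure ℝ)) (x - r) -
      Function.leftLim (cdf (ν : Measure ℝ)) (x - r)| ≤ (kolmogorov μ ν).toReal :=
    le_of_tendsto (((monotone_cdf (μ : Measure ℝ)).tendsto_leftLim (x - r)).sub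
      ((monotone_cdf (ν : Measure ℝ)).tendsto_leftLim (x - r))).abs
      (Eventually.of_forall fun y => abs_cdf_sub_le_kolmogorov μ ν y)
  rw [key, key, ← ENNReal.ofReal_toReal (kolmogorov_ne_top μ ν),
    show (2 : ℝ≥0∞) = ENNReal.ofReal 2 by simp, ← ENNReal.ofReal_mul zero_le_two]
  refine ENNReal.ofReal_le_ofReal ?_
  have h1 := abs_le.1 hlim
  have h2 := abs_le.1 (abs_cdf_sub_le_kolmogorov μ ν (x + r))
  rw [abs_le]
  constructor <;> linarith

/-- `Iic b` is approximated by the balls `[a, b]`; the error is at most `F a + G a`, which vanishes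
as `a → -∞`. -/
theorem kolmogorov_le_discrepancy (μ ν : ProbabilityMeasure ℝ) :
    kolmogorov μ ν ≤ discrepancy μ ν := by
  have hfin : discrepancy μ ν ≠ ∞ :=
    ((discrepancy_le_two_mul_kolmogorov μ ν).trans_lt
      (ENNReal.mul_lt_top (by simp) (kolmogorov_ne_top μ ν).lt_top)).ne
  refine iSup_le fun b => (ENNReal.ofReal_le_iff_le_toReal hfin).2 ?_
  have h1 : ∀ a ≤ b, |cdf (μ : Measure ℝ) b - cdf (ν : Measure ℝ) b| ≤
      (discrepancy μ ν).toReal + cdf (μ : Measure ℝ) a + cdf (ν : Measure ℝ) a := by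
    intro a hab
    have h2 : |(μ : Measure ℝ).real (Set.Icc a b) - (ν : Measure ℝ).real (Set.Icc a b)| ≤
        (discrepancy μ ν).toReal := by
      rw [← ENNReal.ofReal_le_iff_le_toReal hfin, Real.Icc_eq_closedBall, discrepancy]
      exact le_iSup_of_le ((a + b) / 2) (le_iSup_of_le ((b - a) / 2)
        (le_iSup_of_le (by linarith) le_rfl))
    have h3 : ∀ ρ : ProbabilityMeasure ℝ,
        (ρ : Measure ℝ).real (Set.Icc a b) ≤ cdf (ρ : Measure ℝ) b ∧
        cdf (ρ : Measure ℝ) b ≤ cdf (ρ : Measure ℝ) a + (ρ : Measure ℝ).real (Set.Icc a b) := by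
      intro ρ
      rw [cdf_eq_real, cdf_eq_real]
      refine ⟨measureReal_mono Set.Icc_subset_Iic_self, ?_⟩
      rw [← Set.Iic_union_Icc_eq_Iic hab]
      exact measureReal_union_le _ _
    have h4 := h3 μ
    have h5 := h3 ν
    rw [abs_le] at h2 ⊢
    constructor <;> linarith [cdf_nonneg (μ : Measure ℝ) a, cdf_nonneg (ν : Measure ℝ) a]
  have h6 := ((tendsto_cdf_atBot (μ : Measure ℝ)).const_add (discrepancy μ ν).toReal).add
    (tendsto_cdf_atBot (ν : Measure ℝ))
  rw [add_zero, add_zero] at h6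
  exact ge_of_tendsto h6 ((eventually_le_atBot b).mono h1)

theorem impliesWeak_discrepancy : ImpliesWeak (Ω := ℝ) discrepancy :=
  impliesWeak_kolmogorov.mono kolmogorov_le_discrepancy

/-- Absolute continuity of the integral of the density: short intervals have small mass, uniformly
in position. -/
theorem exists_cdf_add_sub_le {ν : ProbabilityMeasure ℝ} (hν : (ν : Measure ℝ) ≪ volume) {η : ℝ}
    (hη : 0 < η) :
    ∃ δ > 0, ∀ x, cdf (ν : Measure ℝ) (x + δ) - cdf (ν : Measure ℝ) x ≤ η := by
  obtain ⟨δ, hδ, h⟩ := exists_pos_setLIntegral_lt_of_measure_lt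
    (μ := volume) (f := (ν : Measure ℝ).rnDeriv volume)
    (by rw [Measure.lintegral_rnDeriv hν]; exact measure_ne_top _ _) (ENNReal.ofReal_pos.2 hη).ne'
  obtain ⟨r, hr, hrδ⟩ : ∃ r : ℝ, 0 < r ∧ ENNReal.ofReal r < δ := by
    obtain ⟨s, hs, hsδ⟩ := exists_between hδ
    have hs' : s ≠ ∞ := (hsδ.trans_le le_top).ne
    exact ⟨s.toReal, ENNReal.toReal_pos hs.ne' hs', by rwa [ENNReal.ofReal_toReal hs']⟩
  refine ⟨r, hr, fun x => ?_⟩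
  rw [← measureReal_Ioc_eq_cdf_sub ν (by linarith : x ≤ x + r)]
  have h1 := h (Set.Ioc x (x + r)) (by simpa using hrδ)
  rw [Measure.setLIntegral_rnDeriv hν] at h1
  exact ENNReal.toReal_le_of_le_ofReal hη.le h1.le

theorem tendsto_kolmogorov_of_tendsto {μ : ℕ → ProbabilityMeasure ℝ} {ν : ProbabilityMeasure ℝ}
    (hν : (ν : Measure ℝ) ≪ volume) (h : Tendsto μ atTop (𝓝 ν)) :
    Tendsto (fun n => kolmogorov (μ n) ν) atTop (𝓝 0) := by
  rw [← ENNReal.tendsto_toReal_zero_iff fun n => kolmogorov_ne_top _ _, Metric.tendsto_nhds]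
  intro η hη
  -- One third of `η` pays for the horizontal Lévy shift, one third for the vertical one; the last
  -- keeps the inequality strict.
  obtain ⟨δ, hδ, hδ'⟩ := exists_cdf_add_sub_le hν (show 0 < η / 3 by linarith)
  have hε : 0 < min δ (η / 3) := lt_min hδ (by linarith)
  filter_upwards [eventually_mem_levySet (tendsto_levy_of_tendsto h) hε] with n hn
  generalize hε' : min δ (η / 3) = ε at *
  have h1 : ε ≤ δ := hε' ▸ min_le_left _ _
  have h2 : ε ≤ η / 3 := hε' ▸ min_le_right _ _
  rw [Real.dist_0_eq_abs, abs_of_nonneg ENNReal.toReal_nonneg]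
  refine (ENNReal.toReal_le_of_le_ofReal (show 0 ≤ 2 * (η / 3) by linarith)
    (iSup_le fun x => ENNReal.ofReal_le_ofReal ?_)).trans_lt (by linarith)
  have h3 := hn.2 x
  have h4 := hδ' x
  have h5 := hδ' (x - ε)
  have h6 := monotone_cdf (ν : Measure ℝ) (show x + ε ≤ x + δ by linarith)
  have h7 := monotone_cdf (ν : Measure ℝ) (show x ≤ x - ε + δ by linarith)
  rw [abs_le]
  constructor <;> linarith

theorem metrizesWeakAt_kolmogorov {ν : ProbabilityMeasure ℝ} (hν : (ν : Measure ℝ) ≪ volume) :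
    MetrizesWeakAt kolmogorov ν :=
  fun μ => ⟨tendsto_kolmogorov_of_tendsto hν, impliesWeak_kolmogorov μ ν⟩

theorem metrizesWeakAt_discrepancy {ν : ProbabilityMeasure ℝ} (hν : (ν : Measure ℝ) ≪ volume) :
    MetrizesWeakAt discrepancy ν := by
  refine fun μ => ⟨fun h => ?_, impliesWeak_discrepancy μ ν⟩
  have h1 := ENNReal.Tendsto.const_mul (a := 2) (tendsto_kolmogorov_of_tendsto hν h)
    (Or.inr (by simp))
  rw [mul_zero] at h1
  exact tendsto_of_tendsto_of_tendsto_of_le_of_le tendsto_const_nhds h1 (fun _ => zero_le)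
    fun n => discrepancy_le_two_mul_kolmogorov _ _

end Real

end ProbMetric

theorem mainTheorem2 :
    -- measures on the real line
    (ProbMetric.MetrizesWeak ProbMetric.levy ∧
      ProbMetric.ImpliesWeak (Ω := ℝ) ProbMetric.discrepancy ∧
      ProbMetric.ImpliesWeak ProbMetric.kolmogorov ∧
      ∀ ν : ProbabilityMeasure ℝ, (ν : Measure ℝ) ≪ volume →
        ProbMetric.MetrizesWeakAt ProbMetric.discrepancy ν ∧
        ProbMetric.MetrizesWeakAt ProbMetric.kolmogorov ν) ∧
    -- measures on a metric space
    (∀ (Ω : Type*) [MetricSpace Ω] [MeasurableSpace Ω] [BorelSpace Ω],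
      (TopologicalSpace.SeparableSpace Ω →
        ProbMetric.MetrizesWeak (Ω := Ω) ProbMetric.prokhorov) ∧
      ProbMetric.ImpliesWeak (Ω := Ω) ProbMetric.wasserstein ∧
      -- bounded spaces
      (BoundedSpace Ω →
        (TopologicalSpace.SeparableSpace Ω →
          ProbMetric.MetrizesWeak (Ω := Ω) ProbMetric.wasserstein) ∧
        ProbMetric.ImpliesWeak (Ω := Ω) ProbMetric.totalVariation ∧
        ProbMetric.ImpliesWeak (Ω := Ω) ProbMetric.hellinger ∧
        (Countable Ω →
          ProbMetric.ImpliesWeak (Ω := Ω) ProbMetric.separation ∧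
          ProbMetric.ImpliesWeak (Ω := Ω) (fun μ ν => ProbMetric.separation ν μ)) ∧
        ProbMetric.ImpliesWeak (Ω := Ω) ProbMetric.relativeEntropy ∧
        ProbMetric.ImpliesWeak (Ω := Ω) (fun μ ν => ProbMetric.relativeEntropy ν μ) ∧
        ProbMetric.ImpliesWeak (Ω := Ω) ProbMetric.chiSquare ∧
        ProbMetric.ImpliesWeak (Ω := Ω) (fun μ ν => ProbMetric.chiSquare ν μ)) ∧
      -- bounded and finite spaces
      (BoundedSpace Ω → Finite Ω →
        ProbMetric.MetrizesWeak (Ω := Ω) ProbMetric.totalVariation ∧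
        ProbMetric.MetrizesWeak (Ω := Ω) ProbMetric.hellinger)) := by
  refine ⟨⟨ProbMetric.metrizesWeak_levy, ProbMetric.impliesWeak_discrepancy,
    ProbMetric.impliesWeak_kolmogorov, fun ν hν => ⟨ProbMetric.metrizesWeakAt_discrepancy hν,
      ProbMetric.metrizesWeakAt_kolmogorov hν⟩⟩, fun Ω _ _ _ => ⟨fun _ =>
    ProbMetric.metrizesWeak_prokhorov, ProbMetric.impliesWeak_wasserstein, fun _ => ⟨fun _ =>
      ProbMetric.metrizesWeak_wasserstein, ProbMetric.impliesWeak_totalVariation,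
      ProbMetric.impliesWeak_hellinger, fun _ => ⟨ProbMetric.impliesWeak_separation,
        ProbMetric.impliesWeak_separation_swap⟩, ProbMetric.impliesWeak_relativeEntropy,
      ProbMetric.impliesWeak_relativeEntropy_swap, ProbMetric.impliesWeak_chiSquare,
      ProbMetric.impliesWeak_chiSquare_swap⟩, fun _ _ =>
    ⟨ProbMetric.metrizesWeak_totalVariation, ProbMetric.metrizesWeak_hellinger⟩⟩⟩
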